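/- Let $\Sigma$ be a finite alphabet and $L\subseteq\Sigma^*$. Put $u^{-1}L=\{w: uw\in L\}$, $L^r=\{w^r : w\in L\}$ where $w^r$ is the reversal of the word $w$, and $\mathsf{LD}(L)=\{u^{-1}L: u\in\Sigma^*\}$. Let $\mathsf{SLD}(L)$, $\mathsf{BLD}(L)$ and $\mathsf{BLRD}(L)$ be the closures of $\mathsf{LD}(L)$ under, respectively, finite unions (including the empty one); all set-theoretic boolean operations; all set-theoretic boolean operations and two-sided derivatives $K\mapsto x^{-1}Ky^{-1}=\{w : xwy\in K\}$. The dependency relation of $L$ is $\mathcal{DR}_L\subseteq \mathsf{LD}(L)\times\mathsf{LD}(L^r)$ with $\mathcal{DR}_L(u^{-1}L,v^{-1}L^r)$ iff $uv^r\in L$. The bipartite dimension $\dim\mathcal R$ of a relation $\mathcal R\subseteq X\times Y$ is the minimum cardinality of a set of bicliques (subsets $B_1\times B_2\subseteq\mathcal R$ with $B_1\subseteq X$, $B_2\subseteq Y$) with union $\mathcal R$. For a regular language $L$, let $\mathrm{ns}(L)$ be the least number of states of a nondeterministic finite automaton (with arbitrary sets of initial and final states, possibly with no states) accepting $L$. Let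 $n_a(L)$ (resp. $n_\mu(L)$) be the least number of states of such an automaton accepting $L$ in which each state accepts a language from $\mathsf{BLD}(L)$ (resp. $\mathsf{BLRD}(L)$). A finite semilattice is a finite poset in which all finite subsets (including the empty one) have joins, and morphisms are the maps preserving finite joins. A morphism is nuclear if it is a composite $S\to D\to T$ of morphisms with $D$ a finite distributive lattice. A regular language $L$ is nuclear if for all $a\in\Sigma$ the morphism $\mathsf{SLD}(L)\to\mathsf{SLD}(L)$, $K\mapsto a^{-1}K$, is nuclear, where $\mathsf{SLD}(L)$ is ordered by inclusion. For a finite semilattice $S$, let $J(S)$ be the set of all $j\in S$ such that $j=\bigvee X$ implies $j\in X$ for every $X\subseteq S$, and let $M(S)$ be the set of all $m\in S$ such that $m=\bigwedge X$ implies $m\in X$ for every $X\subseteq S$. The lattice language $L(S)$ is the set of all words over the disjoint union $\{\langle j| : j\in J(S)\}\cup\{|m\rangle : m\in M(S)\}$ that contain no factor $\langle j|\,|m\rangle$ with $j\leq_S m$. **Proposition.** 1. If $L$ is a nuclear language, then $\mathrm{ns}(L)=\dim \mathcal{DR}_L$. 2. If $L=L(S)$ is the lattice language of a finite semilattice $S$,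 then $n_a(L)=n_\mu(L)=\mathrm{ns}(L)=\dim\mathcal{DR}_L$. All these numbers are finite. -/

import Mathlib

namespace SubatomicNFA

universe u v

section Derivatives

variable {α : Type u}

/-- The set of left derivatives `u⁻¹L = {w | u ++ w ∈ L}` of `L`. -/
def LD (L : Language α) : Set (Language α) := Set.range L.leftQuotient

/-- The two-sided derivative `x⁻¹Ky⁻¹ = {w | x ++ w ++ y ∈ K}`. -/
def twoSidedDerivative (K : Language α) (x y : List α) : Language α :=
  {w : List α | x ++ w ++ y ∈ K}

/-- The closure of the left derivatives of `L` under finite unions (including the empty union). -/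
def SLD (L : Language α) : Set (Language α) :=
  {K | ∃ F : Set (Language α), F.Finite ∧ F ⊆ LD L ∧ K = sSup F}

/-- The closure of the left derivatives of `L` under all set-theoretic boolean operations. -/
def BLD (L : Language α) : BooleanSubalgebra (Language α) :=
  BooleanSubalgebra.closure (LD L)

/-- The closure of the left derivatives of `L` under all set-theoretic boolean operations and
two-sided derivatives. -/
def BLRD (L : Language α) : BooleanSubalgebra (Language α) :=
  sInf {B | LD L ⊆ B ∧ ∀ K ∈ B, ∀ x y : List α, twoSidedDerivative K x y ∈ B}

theorem mem_sSup_language (F : Set (Language α)) (w : List α) :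
    w ∈ sSup F ↔ ∃ K ∈ F, w ∈ K :=
  Set.mem_sUnion

theorem leftQuotient_sSup (F : Set (Language α)) (x : List α) :
    (sSup F).leftQuotient x = sSup ((fun K : Language α => K.leftQuotient x) '' F) := by
  ext w
  simp only [Language.mem_leftQuotient, mem_sSup_language, Set.exists_mem_image]

theorem bot_mem_SLD (L : Language α) : (⊥ : Language α) ∈ SLD L :=
  ⟨∅, Set.finite_empty, Set.empty_subset _, sSup_empty.symm⟩

theorem sup_mem_SLD (L : Language α) {K₁ K₂ : Language α} (h₁ : K₁ ∈ SLD L) (h₂ : K₂ ∈ SLD L) :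
    K₁ ⊔ K₂ ∈ SLD L := by
  obtain ⟨F₁, f₁, s₁, rfl⟩ := h₁
  obtain ⟨F₂, f₂, s₂, rfl⟩ := h₂
  exact ⟨F₁ ∪ F₂, f₁.union f₂, Set.union_subset s₁ s₂, sSup_union.symm⟩

theorem leftQuotient_mem_SLD (L : Language α) {K : Language α} (h : K ∈ SLD L) (x : List α) :
    K.leftQuotient x ∈ SLD L := by
  obtain ⟨F, f, s, rfl⟩ := h
  refine ⟨_, f.image fun K : Language α => K.leftQuotient x, ?_, leftQuotient_sSup F x⟩
  rintro _ ⟨K, hK, rfl⟩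
  obtain ⟨y, rfl⟩ := s hK
  exact ⟨y ++ x, Language.leftQuotient_append L y x⟩

/-- `SLD L` is a join-semilattice with respect to union, ordered by inclusion. -/
instance instSemilatticeSupSLD (L : Language α) : SemilatticeSup (SLD L) :=
  Subtype.semilatticeSup fun _ _ h₁ h₂ => sup_mem_SLD L h₁ h₂

/-- The least element of `SLD L` is the empty language. -/
instance instOrderBotSLD (L : Language α) :
    @OrderBot (SLD L) (instSemilatticeSupSLD L).toPartialOrder.toLE where
  bot := ⟨⊥, bot_mem_SLD L⟩
  bot_le K := bot_le (a := (K : Language α))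

/-- The transition morphism `K ↦ a⁻¹K` of the minimal semilattice automaton `SLD L`. -/
def transition (L : Language α) (a : α) : SupBotHom (SLD L) (SLD L) where
  toFun K := ⟨(K : Language α).leftQuotient [a], leftQuotient_mem_SLD L K.2 [a]⟩
  map_sup' _ _ := Subtype.ext rfl
  map_bot' := Subtype.ext rfl

end Derivatives

section Nuclear

/-- A morphism of finite join-semilattices (preserving all finite joins, including the empty one)
is nuclear if it factorizes through a finite distributive lattice. -/
def IsNuclearHom {S : Type u} {T : Type v} [SemilatticeSup S] [OrderBot S] [SemilatticeSup T]
    [OrderBot T] (f : SupBotHom S T) : Prop :=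
  ∃ (D : Type) (_ : DistribLattice D) (_ : OrderBot D) (_ : Finite D)
    (g : SupBotHom S D) (h : SupBotHom D T), f = h.comp g

/-- A regular language is nuclear if all transition morphisms of its minimal semilattice automaton
are nuclear. -/
def IsNuclear {α : Type u} (L : Language α) : Prop :=
  L.IsRegular ∧ ∀ a : α, IsNuclearHom (transition L a)

end Nuclear

section Dimension

/-- A biclique of a relation `R ⊆ X × Y` is a subset of `R` of the form `B₁ × B₂`. -/
def IsBiclique {X : Type u} {Y : Type v} (R B : Set (X × Y)) : Prop :=
  B ⊆ R ∧ ∃ (B₁ : Set X) (B₂ : Set Y), B = B₁ ×ˢ B₂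

/-- A set of bicliques of `R` whose union is `R`. -/
def IsBicliqueCover {X : Type u} {Y : Type v} (R : Set (X × Y)) (C : Set (Set (X × Y))) : Prop :=
  (∀ B ∈ C, IsBiclique R B) ∧ ⋃₀ C = R

/-- The bipartite dimension of `R`: the minimum cardinality of a biclique cover. -/
noncomputable def bipartiteDim {X : Type u} {Y : Type v} (R : Set (X × Y)) : ℕ∞ :=
  ⨅ (C : Set (Set (X × Y))) (_ : IsBicliqueCover R C), C.encard

variable {α : Type u}

/-- The dependency relation of `L`, relating `x⁻¹L` and `y⁻¹Lʳ` iff `x yʳ ∈ L`. -/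
def DR (L : Language α) : Set (LD L × LD L.reverse) :=
  {p | ∃ x y : List α, p.1.1 = L.leftQuotient x ∧ p.2.1 = L.reverse.leftQuotient y ∧
    x ++ y.reverse ∈ L}

/-- The dependency relation does not depend on the words that represent the derivatives. -/
theorem mem_DR_iff (L : Language α) (x y : List α) :
    ((⟨L.leftQuotient x, x, rfl⟩, ⟨L.reverse.leftQuotient y, y, rfl⟩) : LD L × LD L.reverse) ∈ DR L
      ↔ x ++ y.reverse ∈ L := by
  have key : ∀ a b : List α, b ++ a.reverse ∈ L.reverse ↔ a ++ b.reverse ∈ L := fun a b => by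
    rw [Language.mem_reverse, List.reverse_append, List.reverse_reverse]
  constructor
  · rintro ⟨x', y', hx, hy, h⟩
    have h1 : y'.reverse ∈ L.leftQuotient x := by
      have hx' : L.leftQuotient x = L.leftQuotient x' := hx
      rw [hx']
      exact h
    have h2 : x.reverse ∈ L.reverse.leftQuotient y := by
      have hy' : L.reverse.leftQuotient y = L.reverse.leftQuotient y' := hy
      rw [hy']
      exact (key x y').2 h1
    exact (key x y).1 h2
  · exact fun h => ⟨x, y, rfl, rfl, h⟩

end Dimension

section Complexity

variable {α : Type u}

/-- The nondeterministic state complexity: the least number of states of an nfa accepting `L`. -/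
noncomputable def ns (L : Language α) : ℕ∞ :=
  ⨅ (Q : Type) (_ : Finite Q) (N : NFA α Q) (_ : N.accepts = L), ENat.card Q

/-- Every state of the nfa accepts a language from `BLD L`. -/
def IsAtomic {Q : Type} (N : NFA α Q) (L : Language α) : Prop :=
  ∀ q : Q, N.acceptsFrom {q} ∈ BLD L

/-- Every state of the nfa accepts a language from `BLRD L`. -/
def IsSubatomic {Q : Type} (N : NFA α Q) (L : Language α) : Prop :=
  ∀ q : Q, N.acceptsFrom {q} ∈ BLRD L

/-- The nondeterministic atomic complexity: the least number of states of an atomic nfa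
accepting `L`. -/
noncomputable def nAtomic (L : Language α) : ℕ∞ :=
  ⨅ (Q : Type) (_ : Finite Q) (N : NFA α Q) (_ : N.accepts = L) (_ : IsAtomic N L), ENat.card Q

/-- The nondeterministic syntactic complexity: the least number of states of a subatomic nfa
accepting `L`. -/
noncomputable def nSyntactic (L : Language α) : ℕ∞ :=
  ⨅ (Q : Type) (_ : Finite Q) (N : NFA α Q) (_ : N.accepts = L) (_ : IsSubatomic N L), ENat.card Q

end Complexity

section LatticeLanguage

variable (S : Type u) [SemilatticeSup S]

/-- The join-irreducible elements: `j = ⋁ X` implies `j ∈ X` for every subset `X`. -/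
def joinIrreducibles : Set S := {j | ∀ X : Set S, IsLUB X j → j ∈ X}

/-- The meet-irreducible elements: `m = ⋀ X` implies `m ∈ X` for every subset `X`. -/
def meetIrreducibles : Set S := {m | ∀ X : Set S, IsGLB X m → m ∈ X}

/-- The disjoint union of the join-irreducibles and the meet-irreducibles. -/
abbrev LatticeAlphabet : Type u := joinIrreducibles S ⊕ meetIrreducibles S

/-- The language of all words having no factor `⟨j| |m⟩` with `j ≤ m`. -/
def latticeLanguage : Language (LatticeAlphabet S) :=
  {w : List (LatticeAlphabet S) | ∀ (j : joinIrreducibles S) (m : meetIrreducibles S),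
    (j : S) ≤ m → ¬ [Sum.inl j, Sum.inr m] <:+: w}

end LatticeLanguage

end SubatomicNFA

namespace SubatomicNFA

universe u

variable {α : Type u}

/-! Each state `q` of an nfa for `L` gives a biclique: the derivatives by words reaching `q`, times
the derivatives of the reversal by reversed words accepted from `q`. Hence `dim DR ≤ ns ≤ nSyntactic
≤ nAtomic` for every language. Conversely, the bicliques of a finite cover serve as states of an
nfa. A cover supplies only the sets `e x` of bicliques containing `x⁻¹L`; the transitions need
structure on `L`. If `K ↦ a⁻¹K` factors through a distributive lattice, they go through its
join-irreducibles, which are prime (`mem_acceptsFrom_nuclearNFA`). A lattice language is local, so a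
nonempty derivative by `xa` depends on `a` alone; each state then accepts an intersection of
derivatives, or nothing (`IsResetting.mem_acceptsFrom_singleton`), so the nfa is atomic and the
chain of inequalities closes up. -/

/-- The derivative of the reversal by `y` is determined by which derivatives of `L` contain
`y.reverse`. -/
theorem finite_LD_reverse {L : Language α} (hL : (LD L).Finite) : (LD L.reverse).Finite := by
  have := hL.to_subtype
  let f : Set (LD L) → Language α := fun T => {w | ∃ K ∈ T, K.1 = L.leftQuotient w.reverse}
  refine (Set.finite_range f).subset ?_
  rintro _ ⟨y, rfl⟩
  refine ⟨{K | y.reverse ∈ K.1}, ?_⟩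
  ext w
  change (∃ K : LD L, y.reverse ∈ K.1 ∧ K.1 = L.leftQuotient w.reverse) ↔ y ++ w ∈ L.reverse
  rw [Language.mem_reverse, List.reverse_append]
  constructor
  · rintro ⟨K, hK, e⟩
    rwa [e] at hK
  · exact fun h => ⟨⟨_, w.reverse, rfl⟩, h, rfl⟩

/-- If `L` has finitely many left derivatives, its dependency relation has finite dimension. -/
theorem bipartiteDim_DR_ne_top {L : Language α} (hL : (LD L).Finite) :
    bipartiteDim (DR L) ≠ ⊤ := by
  have := hL.to_subtype
  have := (finite_LD_reverse hL).to_subtype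
  have hcov : IsBicliqueCover (DR L) ((fun p => {p}) '' DR L) := by
    refine ⟨?_, ?_⟩
    · rintro _ ⟨p, hp, rfl⟩
      exact ⟨Set.singleton_subset_iff.2 hp, {p.1}, {p.2}, by simp⟩
    · ext p
      simp
  refine ne_top_of_le_ne_top ?_ (iInf₂_le _ hcov)
  exact Set.encard_ne_top_iff.2 (Set.toFinite _)

/-! ### Lower bound: from automata to biclique covers. -/

theorem mem_acceptsFrom_iff_exists {Q : Type} {N : NFA α Q} {X : Set Q} {w : List α} :
    w ∈ N.acceptsFrom X ↔ ∃ q ∈ X, w ∈ N.acceptsFrom {q} := by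
  conv_lhs => rw [← Set.biUnion_of_singleton X, NFA.acceptsFrom_iUnion₂]
  exact Set.mem_iUnion₂.trans (by simp only [exists_prop]; rfl)

/-- The states of an nfa for `L` induce a biclique cover of the dependency relation of `L`. -/
theorem bipartiteDim_DR_le_card {L : Language α} {Q : Type} (N : NFA α Q) (hN : N.accepts = L) :
    bipartiteDim (DR L) ≤ ENat.card Q := by
  let B₁ : Q → Set (LD L) := fun q => {K | ∃ x, K.1 = L.leftQuotient x ∧ q ∈ N.eval x}
  let B₂ : Q → Set (LD L.reverse) := fun q =>
    {K | ∃ y, K.1 = L.reverse.leftQuotient y ∧ y.reverse ∈ N.acceptsFrom {q}}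
  have key : ∀ x w, x ++ w ∈ L ↔ ∃ q ∈ N.eval x, w ∈ N.acceptsFrom {q} := by
    intro x w
    rw [← hN, NFA.accepts_eq_acceptsFrom_start, NFA.append_mem_acceptsFrom]
    exact mem_acceptsFrom_iff_exists
  have hcov : IsBicliqueCover (DR L) (Set.range fun q => B₁ q ×ˢ B₂ q) := by
    refine ⟨?_, ?_⟩
    · rintro _ ⟨q, rfl⟩
      refine ⟨?_, _, _, rfl⟩
      rintro ⟨K, K'⟩ ⟨⟨x, hx, hq⟩, y, hy, hq'⟩
      exact ⟨x, y, hx, hy, (key _ _).2 ⟨q, hq, hq'⟩⟩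
    · ext ⟨K, K'⟩
      simp only [Set.sUnion_range, Set.mem_iUnion]
      constructor
      · rintro ⟨q, ⟨x, hx, hq⟩, y, hy, hq'⟩
        exact ⟨x, y, hx, hy, (key _ _).2 ⟨q, hq, hq'⟩⟩
      · rintro ⟨x, y, hx, hy, h⟩
        obtain ⟨q, hq, hq'⟩ := (key _ _).1 h
        exact ⟨q, ⟨x, hx, hq⟩, y, hy, hq'⟩
  refine (iInf₂_le _ hcov).trans ?_
  rw [← Set.image_univ, ← Set.encard_univ]
  exact Set.encard_image_le _ _

theorem bipartiteDim_DR_le_ns (L : Language α) : bipartiteDim (DR L) ≤ ns L :=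
  le_iInf fun _ => le_iInf fun _ => le_iInf fun N => le_iInf fun hN =>
    bipartiteDim_DR_le_card N hN

theorem ns_le_nSyntactic (L : Language α) : ns L ≤ nSyntactic L :=
  le_iInf fun Q => le_iInf fun hQ => le_iInf fun N => le_iInf fun hN => le_iInf fun _ =>
    iInf_le_of_le Q <| iInf_le_of_le hQ <| iInf_le_of_le N <| iInf_le _ hN

theorem BLD_le_BLRD (L : Language α) : BLD L ≤ BLRD L :=
  le_sInf fun _ hB => BooleanSubalgebra.closure_le.2 hB.1

theorem nSyntactic_le_nAtomic (L : Language α) : nSyntactic L ≤ nAtomic L :=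
  le_iInf fun Q => le_iInf fun hQ => le_iInf fun N => le_iInf fun hN => le_iInf fun h =>
    iInf_le_of_le Q <| iInf_le_of_le hQ <| iInf_le_of_le N <| iInf_le_of_le hN <|
      iInf_le _ fun q => BLD_le_BLRD L (h q)

/-! ### From biclique covers to candidate state sets. -/

/-- A factorization of the relation `x ++ w ∈ L` through `Q`. -/
def IsFactorization {Q : Type} (L : Language α) (e : List α → Set Q) (β : Q → Language α) : Prop :=
  ∀ x w, x ++ w ∈ L ↔ ∃ q ∈ e x, w ∈ β q

namespace IsFactorization

variable {Q : Type} {L : Language α} {e : List α → Set Q} {β : Q → Language α}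

/-- The only consequence of a factorization that both automaton constructions use; `β` plays no
further role. -/
theorem exists_forall_append_mem (he : IsFactorization L e β) {x w : List α} (h : x ++ w ∈ L) :
    ∃ q ∈ e x, ∀ y, q ∈ e y → y ++ w ∈ L := by
  obtain ⟨q, hq, hw⟩ := (he x w).1 h
  exact ⟨q, hq, fun y hy => (he y w).2 ⟨q, hy, hw⟩⟩

end IsFactorization

/-- A finite biclique cover of the dependency relation of `L` yields a factorization of
`x ++ w ∈ L` of the same size. -/
theorem exists_isFactorization {L : Language α} {C : Set (Set (LD L × LD L.reverse))}
    (hC : IsBicliqueCover (DR L) C) (hfin : C.Finite) :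
    ∃ (Q : Type) (_ : Finite Q) (e : List α → Set Q) (β : Q → Language α),
      IsFactorization L e β ∧ ENat.card Q = C.encard := by
  have := hfin.to_subtype
  -- The cover lives in the universe of `α`, whereas states must form a `Type`; hence the reindexing
  -- by `Fin n`.
  obtain ⟨n, ⟨f⟩⟩ := Finite.exists_equiv_fin C
  choose B₁ B₂ hB using fun i : Fin n => (hC.1 (f.symm i).1 (f.symm i).2).2
  refine ⟨Fin n, inferInstance, fun x => {i | ⟨L.leftQuotient x, x, rfl⟩ ∈ B₁ i},
    fun i => {w | ⟨L.reverse.leftQuotient w.reverse, w.reverse, rfl⟩ ∈ B₂ i}, ?_, ?_⟩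
  · intro x w
    have h := mem_DR_iff L x w.reverse
    rw [List.reverse_reverse] at h
    rw [← h, ← hC.2, Set.mem_sUnion]
    constructor
    · rintro ⟨B, hBC, hm⟩
      obtain ⟨i, hi⟩ := f.symm.surjective ⟨B, hBC⟩
      have hi' : (f.symm i).1 = B := congrArg Subtype.val hi
      rw [← hi', hB] at hm
      exact ⟨i, hm.1, hm.2⟩
    · rintro ⟨i, h₁, h₂⟩
      refine ⟨_, (f.symm i).2, ?_⟩
      rw [hB]
      exact ⟨h₁, h₂⟩
  · rw [← ENat.card_congr f]
    rfl

theorem le_bipartiteDim_DR {L : Language α} {n : ℕ∞}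
    (h : ∀ (Q : Type) [Finite Q] (e : List α → Set Q) (β : Q → Language α),
      IsFactorization L e β → n ≤ ENat.card Q) :
    n ≤ bipartiteDim (DR L) := by
  refine le_iInf₂ fun C hC => ?_
  by_cases hfin : C.Finite
  · obtain ⟨Q, _, e, β, he, hcard⟩ := exists_isFactorization hC hfin
    exact (h Q e β he).trans_eq hcard
  · rw [Set.Infinite.encard_eq hfin]
    exact le_top

/-! ### Upper bound for nuclear languages. -/

section Nuclear

variable {Q : Type} {L : Language α} {D : α → Type} [∀ a, DistribLattice (D a)]
  [∀ a, OrderBot (D a)]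

theorem leftQuotient_self_mem_SLD (L : Language α) (x : List α) : L.leftQuotient x ∈ SLD L :=
  ⟨{L.leftQuotient x}, Set.finite_singleton _, by rintro _ rfl; exact ⟨x, rfl⟩, by simp⟩

/-- The left derivative as an element of `SLD L`. -/
def derivative (L : Language α) (x : List α) : SLD L :=
  ⟨L.leftQuotient x, leftQuotient_self_mem_SLD L x⟩

/-- The nfa on `Q` induced by factorizations of the transition morphisms of `L`. -/
def nuclearNFA (L : Language α) (e : List α → Set Q) (g : ∀ a, SupBotHom (SLD L) (D a))
    (h : ∀ a, SupBotHom (D a) (SLD L)) : NFA α Q where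
  start := e []
  accept := {q | ∀ x, q ∈ e x → x ∈ L}
  step q a := {q' | ∃ j : D a, SupIrred j ∧ (∀ x, q ∈ e x → j ≤ g a (derivative L x)) ∧
    ∃ y, derivative L y ≤ h a j ∧ q' ∈ e y}

theorem mem_coe_finset_sup_SLD {ι : Type*} (s : Finset ι) (f : ι → SLD L) (w : List α) :
    w ∈ (s.sup f).1 ↔ ∃ i ∈ s, w ∈ (f i).1 := by
  classical
  induction s using Finset.induction_on with
  | empty =>
    simp only [Finset.sup_empty, Finset.notMem_empty, false_and, exists_false, iff_false]
    exact fun h => h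
  | insert i s _ ih =>
    rw [Finset.sup_insert]
    change w ∈ (f i).1 ∨ w ∈ (s.sup f).1 ↔ _
    simp [ih]

/-- Induction needs arbitrary sets `W` of words: one letter leads from a single derivative to a
union of derivatives. -/
theorem mem_acceptsFrom_nuclearNFA [Finite Q] [∀ a, Finite (D a)] {e : List α → Set Q}
    {β : Q → Language α} (hL : (LD L).Finite) (he : IsFactorization L e β)
    {g : ∀ a, SupBotHom (SLD L) (D a)} {h : ∀ a, SupBotHom (D a) (SLD L)}
    (hgh : ∀ a, transition L a = (h a).comp (g a)) (w : List α) (W : Set (List α)) :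
    w ∈ (nuclearNFA L e g h).acceptsFrom (⋃ x ∈ W, e x) ↔ ∃ x ∈ W, x ++ w ∈ L := by
  classical
  induction w generalizing W with
  | nil =>
    simp only [NFA.nil_mem_acceptsFrom, Set.mem_iUnion₂, List.append_nil]
    constructor
    · rintro ⟨q, ⟨x, hx, hq⟩, hacc⟩
      exact ⟨x, hx, hacc x hq⟩
    · rintro ⟨x, hx, hxL⟩
      obtain ⟨q, hq, hall⟩ := he.exists_forall_append_mem (w := []) (by simpa using hxL)
      exact ⟨q, ⟨x, hx, hq⟩, fun y hy => by simpa using hall y hy⟩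
  | cons a w ih =>
    let K : SLD L := ⟨sSup (L.leftQuotient '' W), L.leftQuotient '' W,
      hL.subset (Set.image_subset_range _ _), Set.image_subset_range _ _, rfl⟩
    have hKmem : ∀ v, v ∈ K.1 ↔ ∃ x ∈ W, x ++ v ∈ L := by
      intro v
      change v ∈ sSup _ ↔ _
      rw [mem_sSup_language]
      simp
    have hK : ∀ v, v ∈ (h a (g a K)).1 ↔ ∃ x ∈ W, x ++ a :: v ∈ L := by
      intro v
      have : h a (g a K) = transition L a K := by rw [hgh]; rfl
      rw [this]
      exact hKmem (a :: v)
    have hstep : (nuclearNFA L e g h).stepSet (⋃ x ∈ W, e x) a =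
        ⋃ y ∈ {y | ∃ j : D a, SupIrred j ∧ j ≤ g a K ∧ derivative L y ≤ h a j}, e y := by
      ext q'
      simp only [NFA.mem_stepSet, Set.mem_iUnion₂]
      constructor
      · rintro ⟨q, ⟨x, hx, hq⟩, j, hj, hjle, y, hy, hq'⟩
        refine ⟨y, ⟨j, hj, (hjle x hq).trans (OrderHomClass.mono (g a) ?_), hy⟩, hq'⟩
        exact fun v hv => (hKmem v).2 ⟨x, hx, hv⟩
      -- Distributivity enters here. If every `q` fails, each has a witness `b q` with `j ≰ g a
      -- (derivative L (b q))`. These finitely many derivatives still cover `K`, so primality of `j`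
      -- gives a contradiction.
      · rintro ⟨y, ⟨j, hj, hjle, hy⟩, hq'⟩
        by_contra hcon
        -- Membership is a premise inside the existential, so that `b` is total; its values off this
        -- set are irrelevant.
        have hbad : ∀ q : Q, ∃ x, q ∈ (⋃ x ∈ W, e x) → q ∈ e x ∧ ¬ j ≤ g a (derivative L x) := by
          intro q
          by_contra hq
          push Not at hq
          refine hcon ⟨q, ?_, j, hj, fun x hx => (hq x).2 hx, y, hy, hq'⟩
          simpa using (hq []).1
        choose b hb using hbad
        have hX : (⋃ x ∈ W, e x).Finite := Set.toFinite _
        have hle : K ≤ hX.toFinset.sup fun q => derivative L (b q) := by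
          intro v hv
          obtain ⟨x, hx, hxv⟩ := (hKmem v).1 hv
          obtain ⟨q, hq, hall⟩ := he.exists_forall_append_mem hxv
          have hqX : q ∈ ⋃ x ∈ W, e x := Set.mem_iUnion₂.2 ⟨x, hx, hq⟩
          exact (mem_coe_finset_sup_SLD _ _ _).2 ⟨q, hX.mem_toFinset.2 hqX, hall _ (hb q hqX).1⟩
        have hjle' := hjle.trans (OrderHomClass.mono (g a) hle)
        rw [map_finset_sup] at hjle'
        obtain ⟨q, hq, hjq⟩ := hj.supPrime.le_finset_sup.1 hjle'
        exact (hb q (hX.mem_toFinset.1 hq)).2 hjq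
    rw [NFA.cons_mem_acceptsFrom, hstep, ih, ← hK]
    constructor
    · rintro ⟨y, ⟨j, hj, hjle, hy⟩, hyw⟩
      exact OrderHomClass.mono (h a) hjle (hy hyw)
    · intro hw
      -- Since `h a` preserves joins, `w` lies in some `h a j` with `j` irreducible, hence in one of
      -- the derivatives that make up `h a j`.
      obtain ⟨s, hs, hirr⟩ := exists_supIrred_decomposition (g a K)
      rw [← hs, map_finset_sup, mem_coe_finset_sup_SLD] at hw
      obtain ⟨j, hj, hwj⟩ := hw
      obtain ⟨F, -, hF, hFeq⟩ := (h a j).2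
      change w ∈ (h a j).1 at hwj
      rw [hFeq, mem_sSup_language] at hwj
      obtain ⟨_, hM, hwM⟩ := hwj
      obtain ⟨y, rfl⟩ := hF hM
      refine ⟨y, ⟨j, hirr hj, hs ▸ Finset.le_sup (f := id) hj, ?_⟩, hwM⟩
      change L.leftQuotient y ≤ (h a j).1
      rw [hFeq]
      exact le_sSup hM

theorem accepts_nuclearNFA [Finite Q] [∀ a, Finite (D a)] {e : List α → Set Q}
    {β : Q → Language α} (hL : (LD L).Finite) (he : IsFactorization L e β)
    {g : ∀ a, SupBotHom (SLD L) (D a)} {h : ∀ a, SupBotHom (D a) (SLD L)}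
    (hgh : ∀ a, transition L a = (h a).comp (g a)) : (nuclearNFA L e g h).accepts = L := by
  ext w
  have := mem_acceptsFrom_nuclearNFA hL he hgh w {[]}
  simpa [NFA.accepts_eq_acceptsFrom_start, nuclearNFA] using this

theorem IsNuclear.ns_eq_bipartiteDim (hL : IsNuclear L) : ns L = bipartiteDim (DR L) := by
  refine le_antisymm (le_bipartiteDim_DR fun Q _ e β he => ?_) (bipartiteDim_DR_le_ns L)
  choose D _ _ _ g h hgh using hL.2
  exact iInf_le_of_le Q <| iInf_le_of_le ‹_› <| iInf_le_of_le (nuclearNFA L e g h) <|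
    iInf_le _ (accepts_nuclearNFA hL.1.finite_range_leftQuotient he hgh)

end Nuclear

/-! ### Upper bound for lattice languages, by atomic automata. -/

section Resetting

/-- Every letter resets the nonempty left derivatives of `L`: a nonempty derivative by a word
depends only on the last letter of that word. -/
def IsResetting (L : Language α) : Prop :=
  ∀ x a v w, x ++ a :: v ∈ L → (x ++ a :: w ∈ L ↔ a :: w ∈ L)

variable {L : Language α}

theorem IsResetting.finite_LD [Finite α] (hL : IsResetting L) : (LD L).Finite := by
  refine ((Set.finite_range fun a : α => L.leftQuotient [a]).union
    (Set.toFinite {L, ⊥})).subset ?_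
  rintro _ ⟨x, rfl⟩
  rcases List.eq_nil_or_concat x with rfl | ⟨x, a, rfl⟩
  · simp
  · rw [List.concat_eq_append]
    by_cases h : ∃ v, x ++ a :: v ∈ L
    · obtain ⟨v, hv⟩ := h
      refine Or.inl ⟨a, ?_⟩
      ext w
      simpa using (hL x a v w hv).symm
    · refine Or.inr (Or.inr ?_)
      push Not at h
      refine Set.eq_empty_of_forall_notMem fun w hw => h w ?_
      simpa using (Language.mem_leftQuotient _ _).1 hw

variable {Q : Type}

/-- The nfa on `Q` induced by a factorization of a resetting language. -/
def resettingNFA (L : Language α) (e : List α → Set Q) : NFA α Q where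
  start := e []
  accept := {q | (∃ x, q ∈ e x) ∧ ∀ x, q ∈ e x → x ∈ L}
  -- The target ignores `q` because `a` resets. The first conjunct makes a state lying in no `e x`
  -- accept nothing, where the universal condition would be vacuous.
  step q a := {q' | (∃ x, q ∈ e x) ∧ (∀ x, q ∈ e x → ∃ v, x ++ a :: v ∈ L) ∧ q' ∈ e [a]}

/-- Resetting trades `x ++ a :: w ∈ L` for `a :: w ∈ L` and back; the factorization at `[a]` then
provides a successor all of whose words can be continued by `w`. -/
theorem IsResetting.mem_acceptsFrom_singleton (hL : IsResetting L) {e : List α → Set Q}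
    {β : Q → Language α} (he : IsFactorization L e β) (w : List α) (q : Q) :
    w ∈ (resettingNFA L e).acceptsFrom {q} ↔ (∃ x, q ∈ e x) ∧ ∀ x, q ∈ e x → x ++ w ∈ L := by
  induction w generalizing q with
  | nil => simp [resettingNFA, NFA.nil_mem_acceptsFrom]
  | cons a w ih =>
    rw [NFA.cons_mem_acceptsFrom, NFA.stepSet_singleton, mem_acceptsFrom_iff_exists]
    simp only [ih]
    constructor
    · rintro ⟨q', ⟨hq, hall, hq'⟩, -, h⟩
      refine ⟨hq, fun x hx => ?_⟩
      obtain ⟨v, hv⟩ := hall x hx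
      exact (hL x a v w hv).2 (h [a] hq')
    · rintro ⟨⟨x, hx⟩, h⟩
      have haw : [a] ++ w ∈ L := (hL x a w w (h x hx)).1 (h x hx)
      obtain ⟨q', hq', hall⟩ := he.exists_forall_append_mem haw
      exact ⟨q', ⟨⟨x, hx⟩, fun y hy => ⟨w, h y hy⟩, hq'⟩, ⟨[a], hq'⟩, hall⟩

theorem IsResetting.accepts_resettingNFA (hL : IsResetting L) {e : List α → Set Q}
    {β : Q → Language α} (he : IsFactorization L e β) : (resettingNFA L e).accepts = L := by
  ext w
  rw [NFA.accepts_eq_acceptsFrom_start, mem_acceptsFrom_iff_exists]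
  simp only [hL.mem_acceptsFrom_singleton he]
  constructor
  · rintro ⟨q, hq, -, h⟩
    exact h [] hq
  · intro hw
    obtain ⟨q, hq, hall⟩ := he.exists_forall_append_mem (x := []) hw
    exact ⟨q, hq, ⟨[], hq⟩, hall⟩

theorem sInf_mem_BLD {F : Set (Language α)} (hfin : F.Finite) (hF : F ⊆ LD L) :
    sInf F ∈ BLD L := by
  induction F, hfin using Set.Finite.induction_on with
  | empty =>
    rw [sInf_empty]
    exact BooleanSubalgebra.top_mem
  | insert _ _ ih =>
    rw [sInf_insert]
    exact BooleanSubalgebra.inf_mem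
      (BooleanSubalgebra.subset_closure (hF (Set.mem_insert _ _)))
      (ih ((Set.subset_insert _ _).trans hF))

theorem IsResetting.isAtomic_resettingNFA [Finite α] (hL : IsResetting L) {e : List α → Set Q}
    {β : Q → Language α} (he : IsFactorization L e β) : IsAtomic (resettingNFA L e) L := by
  intro q
  by_cases hq : ∃ x, q ∈ e x
  · have : (resettingNFA L e).acceptsFrom {q} = sInf (L.leftQuotient '' {x | q ∈ e x}) := by
      ext w
      rw [hL.mem_acceptsFrom_singleton he]
      have : w ∈ sInf (L.leftQuotient '' {x | q ∈ e x}) ↔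
          ∀ K ∈ L.leftQuotient '' {x | q ∈ e x}, w ∈ K := Set.mem_sInter
      rw [this]
      simp [hq]
    rw [this]
    exact sInf_mem_BLD (hL.finite_LD.subset (Set.image_subset_range _ _))
      (Set.image_subset_range _ _)
  · have : (resettingNFA L e).acceptsFrom {q} = ⊥ := by
      refine Set.eq_empty_of_forall_notMem fun w hw => hq ?_
      exact ((hL.mem_acceptsFrom_singleton he w q).1 hw).1
    rw [this]
    exact BooleanSubalgebra.bot_mem

theorem IsResetting.nAtomic_le_bipartiteDim [Finite α] (hL : IsResetting L) :
    nAtomic L ≤ bipartiteDim (DR L) :=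
  le_bipartiteDim_DR fun Q _ e _ he =>
    iInf_le_of_le Q <| iInf_le_of_le ‹_› <| iInf_le_of_le (resettingNFA L e) <|
      iInf_le_of_le (hL.accepts_resettingNFA he) <| iInf_le _ (hL.isAtomic_resettingNFA he)

/-- A condition on adjacent letters splits at `a` into one on `x ++ [a]` and one on the suffix from
`a` on. -/
theorem isResetting_of_isChain {R : α → α → Prop}
    (hR : ∀ w, w ∈ L ↔ w.IsChain R) : IsResetting L := by
  intro x a v w hv
  rw [hR, List.isChain_split] at hv
  rw [hR, hR, List.isChain_split]
  exact and_iff_right hv.1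

theorem isResetting_latticeLanguage (S : Type u) [SemilatticeSup S] :
    IsResetting (latticeLanguage S) := by
  refine isResetting_of_isChain (R := fun p q => ∀ (j : joinIrreducibles S)
    (m : meetIrreducibles S), (j : S) ≤ m → ¬ (p = Sum.inl j ∧ q = Sum.inr m)) fun w => ?_
  rw [List.isChain_iff_forall_rel_of_append_cons_cons]
  constructor
  · rintro h p q l₁ l₂ rfl j m hjm ⟨rfl, rfl⟩
    exact h j m hjm ⟨l₁, l₂, by simp⟩
  · rintro h j m hjm ⟨l₁, l₂, hw⟩
    exact h (l₁ := l₁) (l₂ := l₂) (by rw [← hw]; simp) j m hjm ⟨rfl, rfl⟩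

end Resetting

end SubatomicNFA

theorem mainTheorem5 :
    (∀ (α : Type*) [Finite α] (L : Language α), SubatomicNFA.IsNuclear L →
      SubatomicNFA.ns L = SubatomicNFA.bipartiteDim (SubatomicNFA.DR L) ∧
      SubatomicNFA.bipartiteDim (SubatomicNFA.DR L) ≠ ⊤) ∧
    (∀ (S : Type*) [SemilatticeSup S] [OrderBot S] [Finite S],
      SubatomicNFA.nAtomic (SubatomicNFA.latticeLanguage S) =
        SubatomicNFA.nSyntactic (SubatomicNFA.latticeLanguage S) ∧
      SubatomicNFA.nSyntactic (SubatomicNFA.latticeLanguage S) =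
        SubatomicNFA.ns (SubatomicNFA.latticeLanguage S) ∧
      SubatomicNFA.ns (SubatomicNFA.latticeLanguage S) =
        SubatomicNFA.bipartiteDim (SubatomicNFA.DR (SubatomicNFA.latticeLanguage S)) ∧
      SubatomicNFA.bipartiteDim (SubatomicNFA.DR (SubatomicNFA.latticeLanguage S)) ≠ ⊤) := by
  refine ⟨fun α _ L hL => ⟨hL.ns_eq_bipartiteDim,
    SubatomicNFA.bipartiteDim_DR_ne_top hL.1.finite_range_leftQuotient⟩, fun S _ _ _ => ?_⟩
  have hR := SubatomicNFA.isResetting_latticeLanguage S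
  have h₁ := SubatomicNFA.nSyntactic_le_nAtomic (SubatomicNFA.latticeLanguage S)
  have h₂ := SubatomicNFA.ns_le_nSyntactic (SubatomicNFA.latticeLanguage S)
  have h₃ := SubatomicNFA.bipartiteDim_DR_le_ns (SubatomicNFA.latticeLanguage S)
  have h₄ := hR.nAtomic_le_bipartiteDim
  exact ⟨le_antisymm (h₄.trans (h₃.trans h₂)) h₁, le_antisymm (h₁.trans (h₄.trans h₃)) h₂,
    le_antisymm (h₂.trans (h₁.trans h₄)) h₃, SubatomicNFA.bipartiteDim_DR_ne_top hR.finite_LD⟩
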